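/- A \emph{measure on the binary tree} is a function $P:\{0,1\}^*\to\mathbb{Q}_{\ge 0}$ with $P(\text{empty word})=1$ and $P(x0)+P(x1)=P(x)$ for every string $x$; it is \emph{computable} if some algorithm outputs $P(x)$ on input $x$. For such $P$ put $P(b\mid x)=P(xb)/P(x)$. Fix an optimal prefix-free machine $U$, and let the prefix complexity $K(P)$ of a computable measure $P$ be the least length of a $U$-description of a program that computes $P$. A \emph{best explanation} of a string $x$ is a computable measure $Q$ that minimizes $3K(Q)-\log_2 Q(x)$ among all computable measures (the value being $+\infty$ if $Q(x)=0$). Every string $x$ has a best explanation. For each $x$ choose one of the best explanations $Q_x$ of $x$, and put $H(b\mid x)=Q_x(xb)/Q_x(x)$. Then for every computable measure $P$ on the binary tree \[ \sum_{x\in\{0,1\}^*} P(x)\,[P(0\mid x)-H(0\mid x)]^2<\infty \] (terms with $P(x)=0$ are $0$). Moreover, this sum is at most $C\cdot K(P)\,2^{1.5K(P)}$, where the constant $C$ depends only on $U$, and not on $P$ or on the choice of the best explanations. -/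

import Mathlib

/-- A probability distribution (measure) on the binary tree with rational values: a nonnegative
function on binary strings with value `1` at the empty word and `P x = P (x0) + P (x1)`.
The bit `0` is `false`, the bit `1` is `true`. -/
structure TreeMeasure where
  /-- The probability that the random sequence starts with the given string. -/
  val : List Bool → ℚ
  nonneg : ∀ x, 0 ≤ val x
  val_nil : val [] = 1
  val_append : ∀ x, val (x ++ [false]) + val (x ++ [true]) = val x

/-- The program `c` computes `P`: on input `x` it halts and outputs `P x`, written as a fraction
with natural numerator and nonzero denominator. -/
def TreeMeasure.ComputedBy (P : TreeMeasure) (c : Nat.Partrec.Code) : Prop :=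
  ∀ x : List Bool, ∃ a b : ℕ, b ≠ 0 ∧ Nat.pair a b ∈ c.eval (Encodable.encode x) ∧
    P.val x = (a : ℚ) / (b : ℚ)

/-- `P` is computable: some program computes it. -/
def TreeMeasure.IsComputable (P : TreeMeasure) : Prop :=
  ∃ c : Nat.Partrec.Code, P.ComputedBy c

/-- The predicted probability `P(b | x) = P(xb) / P(x)` that the bit `b` follows `x`. -/
def TreeMeasure.cond (P : TreeMeasure) (b : Bool) (x : List Bool) : ℚ :=
  P.val (x ++ [b]) / P.val x

/-- A prefix-free machine (decompressor): a partial computable function on binary strings such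
that no string of its domain is a proper prefix of another one. -/
def IsPrefixMachine (U : List Bool →. ℕ) : Prop :=
  Partrec U ∧ ∀ p q : List Bool, (U p).Dom → (U q).Dom → p <+: q → p = q

/-- An optimal prefix-free machine: it yields descriptions that are, up to an additive constant,
at least as short as those of any other prefix-free machine. -/
def IsOptimalPrefixMachine (U : List Bool →. ℕ) : Prop :=
  IsPrefixMachine U ∧ ∀ V : List Bool →. ℕ, IsPrefixMachine V →
    ∃ c : ℕ, ∀ (p : List Bool) (n : ℕ), n ∈ V p → ∃ q : List Bool, n ∈ U q ∧
      q.length ≤ p.length + c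

/-- The prefix complexity `K(P)` of a computable measure `P`, with respect to the machine `U`:
the least length of a `U`-description of a program that computes `P`. (For optimal `U` and
computable `P` such descriptions exist.) -/
noncomputable def TreeMeasure.prefixComplexity (U : List Bool →. ℕ) (P : TreeMeasure) : ℕ :=
  sInf {k : ℕ | ∃ (p : List Bool) (c : Nat.Partrec.Code),
    p.length = k ∧ Encodable.encode c ∈ U p ∧ P.ComputedBy c}

open Classical in
/-- The quality `3 K(Q) - log₂ Q(x)` of `Q` as an explanation for `x` (smaller is better);
it is `+∞` if `Q(x) = 0`. -/
noncomputable def TreeMeasure.quality (U : List Bool →. ℕ) (Q : TreeMeasure) (x : List Bool) :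
    EReal :=
  if Q.val x = 0 then ⊤
  else ((3 * (Q.prefixComplexity U : ℝ) - Real.logb 2 (Q.val x : ℝ) : ℝ) : EReal)

/-- `Q` is a best explanation for `x`: it has minimal quality among all computable measures. -/
def IsBestExplanation (U : List Bool →. ℕ) (x : List Bool) (Q : TreeMeasure) : Prop :=
  Q.IsComputable ∧ ∀ Q' : TreeMeasure, Q'.IsComputable → Q.quality U x ≤ Q'.quality U x

/-!
The sum is bounded by a Hellinger-distance argument.

For two measures `P`, `Q` on the binary tree, the sum of `√(P x * Q x)` over the strings `x` of
length `n` does not increase with `n`, and at each node it drops by at least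
`√(P x * Q x) * (P(0 | x) - Q(0 | x))² / 4` (`sqrt_mul_add_sqrt_mul_add_le`). Telescoping gives
`∑ x, √(P x * Q x) * (P(0 | x) - Q(0 | x))² ≤ 4` (`TreeMeasure.sum_sqrt_mul_sq_le`).

If `Q` is a best explanation of `x`, comparing its quality with that of `P` gives
`Q x ≥ P x * 2 ^ (3 * (K(Q) - K(P)))`, hence `P x ≤ √(P x * Q x) * 2 ^ (3 / 2 * (K(P) - K(Q)))`
(`IsBestExplanation.val_le`). So the strings explained by one `Q` contribute at most
`4 * 2 ^ (3 / 2 * (K(P) - K(Q)))` to the sum. The explanations `Q` have distinct shortest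
descriptions `p`, and `∑ p, 2 ^ (-3 / 2 * |p|) = ∑ n, 2 ^ (-n / 2)` converges, so the total is
at most a constant times `2 ^ (3 / 2 * K(P))`. Finally `K(P) ≥ 1`, because an optimal machine is
undefined on the empty word (`TreeMeasure.IsComputable.prefixComplexity_pos`).

A best explanation exists because some computable measure (the uniform one) is positive at `x`,
and only finitely many measures have complexity small enough to compete with it.
-/

/-! ### Sums over binary strings -/

/-- The binary strings of length `n`. -/
noncomputable def boolStrings (n : ℕ) : Finset (List Bool) :=
  (List.finite_length_eq Bool n).toFinset

theorem mem_boolStrings {n : ℕ} {x : List Bool} : x ∈ boolStrings n ↔ x.length = n := by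
  simp [boolStrings]

theorem sum_boolStrings_zero (f : List Bool → ℝ) : ∑ x ∈ boolStrings 0, f x = f [] := by
  have : boolStrings 0 = {[]} := by ext x; simp [mem_boolStrings]
  simp [this]

theorem sum_boolStrings_succ (f : List Bool → ℝ) (n : ℕ) :
    ∑ x ∈ boolStrings (n + 1), f x =
      ∑ x ∈ boolStrings n, (f (x ++ [false]) + f (x ++ [true])) := by
  have himage : boolStrings (n + 1) =
      (boolStrings n ×ˢ Finset.univ).image fun y : List Bool × Bool => y.1 ++ [y.2] := by
    ext x
    simp only [Finset.mem_image, Finset.mem_product, mem_boolStrings, Finset.mem_univ, and_true,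
      Prod.exists]
    constructor
    · intro hx
      have hne : x ≠ [] := by rintro rfl; simp at hx
      exact ⟨x.dropLast, x.getLast hne, by simp [hx], List.dropLast_append_getLast hne⟩
    · rintro ⟨y, b, rfl, rfl⟩
      simp
  rw [himage, Finset.sum_image, Finset.sum_product]
  · simp [add_comm]
  · rintro ⟨y, b⟩ - ⟨z, c⟩ - h
    simpa using h

theorem card_boolStrings (n : ℕ) : ((boolStrings n).card : ℝ) = 2 ^ n := by
  induction n with
  | zero => simpa using sum_boolStrings_zero fun _ => 1
  | succ n ih =>
    have h := sum_boolStrings_succ (fun _ => 1) n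
    simp only [Finset.sum_const, nsmul_eq_mul, ih, mul_one] at h
    rw [h]
    ring

/-- A nonnegative function on strings has finite sums at most `c` if its sums over the levels of
the binary tree up to any given depth are at most `c`. -/
theorem sum_le_of_sum_boolStrings_le {f : List Bool → ℝ} (hf : ∀ x, 0 ≤ f x) {c : ℝ}
    (h : ∀ N, ∑ n ∈ Finset.range N, ∑ x ∈ boolStrings n, f x ≤ c) (s : Finset (List Bool)) :
    ∑ x ∈ s, f x ≤ c := by
  refine le_trans ?_ (h (s.sup List.length + 1))
  rw [← Finset.sum_biUnion]
  · refine Finset.sum_le_sum_of_subset_of_nonneg (fun x hx => ?_) fun x _ _ => hf x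
    simp only [Finset.mem_biUnion, Finset.mem_range, mem_boolStrings]
    exact ⟨_, Nat.lt_succ_of_le (Finset.le_sup (f := List.length) hx), rfl⟩
  · intro m _ n _ hmn
    refine Finset.disjoint_left.2 fun x hx hx' => hmn ?_
    rw [← mem_boolStrings.1 hx, ← mem_boolStrings.1 hx']

theorem two_rpow_neg_half_lt_one : (2 : ℝ) ^ (-(1 / 2) : ℝ) < 1 :=
  Real.rpow_lt_one_of_one_lt_of_neg (by norm_num) (by norm_num)

/-- The weights `2 ^ (-3 / 2 * |p|)` are summable, as there are only `2 ^ n` strings of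
length `n`. -/
theorem sum_two_rpow_neg_length_le (s : Finset (List Bool)) :
    ∑ p ∈ s, (2 : ℝ) ^ (-(3 / 2) * (p.length : ℝ)) ≤ (1 - (2 : ℝ) ^ (-(1 / 2) : ℝ))⁻¹ := by
  refine sum_le_of_sum_boolStrings_le (fun x => by positivity) (fun N => ?_) s
  have hlevel (n : ℕ) : ∑ p ∈ boolStrings n, (2 : ℝ) ^ (-(3 / 2) * (p.length : ℝ)) =
      ((2 : ℝ) ^ (-(1 / 2) : ℝ)) ^ n := by
    have hconst : ∀ p ∈ boolStrings n,
        (2 : ℝ) ^ (-(3 / 2) * (p.length : ℝ)) = (2 : ℝ) ^ (-(3 / 2) * (n : ℝ)) := by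
      intro p hp
      rw [mem_boolStrings.1 hp]
    rw [Finset.sum_congr rfl hconst, Finset.sum_const, nsmul_eq_mul, card_boolStrings,
      ← Real.rpow_natCast 2 n, ← Real.rpow_add two_pos, ← Real.rpow_natCast,
      ← Real.rpow_mul two_pos.le]
    congr 1
    ring
  simp only [hlevel]
  rw [← tsum_geometric_of_lt_one (by positivity) two_rpow_neg_half_lt_one]
  exact (summable_geometric_of_lt_one (by positivity) two_rpow_neg_half_lt_one).sum_le_tsum _
    fun n _ => by positivity

/-! ### The Hellinger estimate -/

/-- On `[0, 1]` the arithmetic mean exceeds the geometric mean by at least `(p - q)² / 8`. -/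
theorem sqrt_mul_add_sq_le {p q : ℝ} (hp : 0 ≤ p) (hp1 : p ≤ 1) (hq : 0 ≤ q) (hq1 : q ≤ 1) :
    √(p * q) + (p - q) ^ 2 / 8 ≤ (p + q) / 2 := by
  rw [Real.sqrt_mul hp]
  have ha := Real.sqrt_nonneg p
  have hb := Real.sqrt_nonneg q
  have ha1 : √p ≤ 1 := Real.sqrt_le_one.2 hp1
  have hb1 : √q ≤ 1 := Real.sqrt_le_one.2 hq1
  have hpa := Real.sq_sqrt hp
  have hqb := Real.sq_sqrt hq
  generalize √p = a at *
  generalize √q = b at *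
  subst hpa hqb
  have hfour : (a + b) ^ 2 ≤ 4 := by nlinarith
  nlinarith [mul_le_mul_of_nonneg_left hfour (sq_nonneg (a - b))]

/-- One step of the decrease of the Hellinger affinity when masses `P = P₀ + P₁` and
`Q = Q₀ + Q₁` are split. -/
theorem sqrt_mul_add_sqrt_mul_add_le {P P₀ P₁ Q Q₀ Q₁ : ℝ} (hP₀ : 0 ≤ P₀) (hP₁ : 0 ≤ P₁)
    (hQ₀ : 0 ≤ Q₀) (hQ₁ : 0 ≤ Q₁) (hP : P₀ + P₁ = P) (hQ : Q₀ + Q₁ = Q) :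
    √(P₀ * Q₀) + √(P₁ * Q₁) + √(P * Q) * (P₀ / P - Q₀ / Q) ^ 2 / 4 ≤ √(P * Q) := by
  rcases (show 0 ≤ P by linarith).eq_or_lt with hP0 | hPpos
  · have h₀ : P₀ = 0 := by linarith
    have h₁ : P₁ = 0 := by linarith
    simp [h₀, h₁, ← hP0]
  rcases (show 0 ≤ Q by linarith).eq_or_lt with hQ0 | hQpos
  · have h₀ : Q₀ = 0 := by linarith
    have h₁ : Q₁ = 0 := by linarith
    simp [h₀, h₁, ← hQ0]
  have hfactor (a b : ℝ) : √(a * b) = √(P * Q) * √(a / P * (b / Q)) := by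
    rw [← Real.sqrt_mul (by positivity)]
    congr 1
    field_simp
  have hp : P₁ / P = 1 - P₀ / P := by field_simp; linarith
  have hq : Q₁ / Q = 1 - Q₀ / Q := by field_simp; linarith
  have hp0 : 0 ≤ P₀ / P := by positivity
  have hq0 : 0 ≤ Q₀ / Q := by positivity
  have hp1 : P₀ / P ≤ 1 := by rw [div_le_one hPpos]; linarith
  have hq1 : Q₀ / Q ≤ 1 := by rw [div_le_one hQpos]; linarith
  rw [hfactor P₀, hfactor P₁, hp, hq]
  have h₀ := sqrt_mul_add_sq_le hp0 hp1 hq0 hq1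
  have h₁ := sqrt_mul_add_sq_le (sub_nonneg.2 hp1) (sub_le_self 1 hp0) (sub_nonneg.2 hq1)
    (sub_le_self 1 hq0)
  have hsum : √(P₀ / P * (Q₀ / Q)) + √((1 - P₀ / P) * (1 - Q₀ / Q)) +
      (P₀ / P - Q₀ / Q) ^ 2 / 4 ≤ 1 := by
    have hsq : (1 - P₀ / P - (1 - Q₀ / Q)) ^ 2 = (P₀ / P - Q₀ / Q) ^ 2 := by ring
    rw [hsq] at h₁
    linarith
  calc _ = √(P * Q) * (√(P₀ / P * (Q₀ / Q)) + √((1 - P₀ / P) * (1 - Q₀ / Q)) +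
        (P₀ / P - Q₀ / Q) ^ 2 / 4) := by ring
    _ ≤ √(P * Q) * 1 := mul_le_mul_of_nonneg_left hsum (Real.sqrt_nonneg _)
    _ = √(P * Q) := mul_one _

/-- The squared prediction errors, weighted with the geometric mean of the two measures, have
bounded sum. -/
theorem TreeMeasure.sum_sqrt_mul_sq_le (P Q : TreeMeasure) (s : Finset (List Bool)) :
    ∑ x ∈ s, √((P.val x : ℝ) * Q.val x) * ((P.cond false x : ℝ) - Q.cond false x) ^ 2 ≤ 4 := by
  refine sum_le_of_sum_boolStrings_le (fun x => by positivity) (fun N => ?_) s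
  suffices h : ∑ n ∈ Finset.range N, ∑ x ∈ boolStrings n,
      √((P.val x : ℝ) * Q.val x) * ((P.cond false x : ℝ) - Q.cond false x) ^ 2 ≤
      4 - 4 * ∑ x ∈ boolStrings N, √((P.val x : ℝ) * Q.val x) by
    have hnonneg : 0 ≤ ∑ x ∈ boolStrings N, √((P.val x : ℝ) * Q.val x) :=
      Finset.sum_nonneg fun x _ => Real.sqrt_nonneg _
    linarith
  induction N with
  | zero => simp [sum_boolStrings_zero, P.val_nil, Q.val_nil]
  | succ N ih =>
    rw [Finset.sum_range_succ, sum_boolStrings_succ]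
    have hstep : ∑ x ∈ boolStrings N, (√((P.val (x ++ [false]) : ℝ) * Q.val (x ++ [false])) +
          √((P.val (x ++ [true]) : ℝ) * Q.val (x ++ [true])) +
          √((P.val x : ℝ) * Q.val x) * ((P.cond false x : ℝ) - Q.cond false x) ^ 2 / 4) ≤
        ∑ x ∈ boolStrings N, √((P.val x : ℝ) * Q.val x) := by
      refine Finset.sum_le_sum fun x _ => ?_
      have h := sqrt_mul_add_sqrt_mul_add_le (P := P.val x) (Q := Q.val x)
        (Rat.cast_nonneg.2 (P.nonneg (x ++ [false]))) (Rat.cast_nonneg.2 (P.nonneg (x ++ [true])))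
        (Rat.cast_nonneg.2 (Q.nonneg (x ++ [false]))) (Rat.cast_nonneg.2 (Q.nonneg (x ++ [true])))
        (by exact_mod_cast P.val_append x) (by exact_mod_cast Q.val_append x)
      simpa only [TreeMeasure.cond, Rat.cast_div] using h
    rw [Finset.sum_add_distrib, ← Finset.sum_div] at hstep
    linarith

/-! ### Descriptions of computable measures -/

/-- The string `p` is a `U`-description of a program that computes `P`. -/
def TreeMeasure.DescribedBy (U : List Bool →. ℕ) (P : TreeMeasure) (p : List Bool) : Prop :=
  ∃ c : Nat.Partrec.Code, Encodable.encode c ∈ U p ∧ P.ComputedBy c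

theorem TreeMeasure.ComputedBy.unique {P Q : TreeMeasure} {c : Nat.Partrec.Code}
    (hP : P.ComputedBy c) (hQ : Q.ComputedBy c) : P = Q := by
  have hval : P.val = Q.val := by
    funext x
    obtain ⟨a, b, -, hab, hPx⟩ := hP x
    obtain ⟨a', b', -, hab', hQx⟩ := hQ x
    obtain ⟨rfl, rfl⟩ := Nat.pair_eq_pair.1 (Part.mem_unique hab hab')
    rw [hPx, hQx]
  cases P
  cases Q
  cases hval
  rfl

theorem TreeMeasure.DescribedBy.unique {U : List Bool →. ℕ} {P Q : TreeMeasure} {p : List Bool}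
    (hP : P.DescribedBy U p) (hQ : Q.DescribedBy U p) : P = Q := by
  obtain ⟨c, hc, hPc⟩ := hP
  obtain ⟨d, hd, hQd⟩ := hQ
  obtain rfl := Encodable.encode_injective (Part.mem_unique hc hd)
  exact hPc.unique hQd

/-- The unary prefix-free machine, which maps `0ⁿ1` to `n` and is undefined elsewhere: a string is
in its domain if its first `1` is its last bit. -/
def unaryMachine : List Bool →. ℕ := fun p =>
  ((if p.idxOf true + 1 = p.length then some (p.idxOf true) else none : Option ℕ) : Part ℕ)

theorem mem_unaryMachine {p : List Bool} {n : ℕ} :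
    n ∈ unaryMachine p ↔ p.idxOf true + 1 = p.length ∧ p.idxOf true = n := by
  simp [unaryMachine, Part.mem_ofOption, eq_comm]

theorem isPrefixMachine_unaryMachine : IsPrefixMachine unaryMachine := by
  constructor
  · refine Computable.ofOption (Primrec.to_comp ?_)
    have hidx : Primrec fun p : List Bool => p.idxOf true :=
      Primrec.list_idxOf.comp (Primrec.const true) Primrec.id
    exact Primrec.ite (Primrec.eq.comp (Primrec.succ.comp hidx) Primrec.list_length)
      (Primrec.option_some.comp hidx) (Primrec.const none)
  · rintro p q hp hq ⟨r, rfl⟩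
    have hp' := (mem_unaryMachine.1 (Part.get_mem hp)).1
    have hq' := (mem_unaryMachine.1 (Part.get_mem hq)).1
    have hmem : true ∈ p := List.idxOf_lt_length_iff.1 (by omega)
    rw [List.idxOf_append_of_mem hmem, hp', List.length_append] at hq'
    have hr : r = [] := List.length_eq_zero_iff.1 (by omega)
    simp [hr]

theorem mem_unaryMachine_replicate (n : ℕ) :
    n ∈ unaryMachine (List.replicate n false ++ [true]) := by
  have h : (List.replicate n false ++ [true]).idxOf true = n := by
    rw [List.idxOf_append_of_notMem (by simp)]
    simp
  simp [mem_unaryMachine, h]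

theorem IsOptimalPrefixMachine.exists_mem {U : List Bool →. ℕ} (hU : IsOptimalPrefixMachine U)
    (n : ℕ) : ∃ p, n ∈ U p := by
  obtain ⟨c, hc⟩ := hU.2 _ isPrefixMachine_unaryMachine
  obtain ⟨q, hq, -⟩ := hc _ n (mem_unaryMachine_replicate n)
  exact ⟨q, hq⟩

/-- If the empty word described something, it would be the only description, although an optimal
machine describes more than one number. -/
theorem IsOptimalPrefixMachine.not_dom_nil {U : List Bool →. ℕ} (hU : IsOptimalPrefixMachine U) :
    ¬ (U []).Dom := by
  intro hnil
  have hall (n : ℕ) : n ∈ U [] := by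
    obtain ⟨p, hp⟩ := hU.exists_mem n
    obtain rfl := hU.1.2 [] p hnil (Part.dom_iff_mem.2 ⟨n, hp⟩) (List.nil_prefix)
    exact hp
  exact zero_ne_one (Part.mem_unique (hall 0) (hall 1))

theorem TreeMeasure.IsComputable.exists_describedBy {U : List Bool →. ℕ}
    (hU : IsOptimalPrefixMachine U) {P : TreeMeasure} (hP : P.IsComputable) :
    ∃ p, p.length = P.prefixComplexity U ∧ P.DescribedBy U p := by
  obtain ⟨c, hc⟩ := hP
  obtain ⟨p, hp⟩ := hU.exists_mem (Encodable.encode c)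
  have hne : {k : ℕ | ∃ (p : List Bool) (c : Nat.Partrec.Code),
      p.length = k ∧ Encodable.encode c ∈ U p ∧ P.ComputedBy c}.Nonempty :=
    ⟨p.length, p, c, rfl, hp, hc⟩
  obtain ⟨q, d, hlen, hq, hd⟩ := Nat.sInf_mem hne
  exact ⟨q, hlen, d, hq, hd⟩

theorem TreeMeasure.IsComputable.prefixComplexity_pos {U : List Bool →. ℕ}
    (hU : IsOptimalPrefixMachine U) {P : TreeMeasure} (hP : P.IsComputable) :
    0 < P.prefixComplexity U := by
  obtain ⟨p, hlen, c, hc, -⟩ := hP.exists_describedBy hU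
  rw [← hlen, List.length_pos_iff]
  rintro rfl
  exact hU.not_dom_nil (Part.dom_iff_mem.2 ⟨_, hc⟩)

theorem finite_setOf_prefixComplexity_le {U : List Bool →. ℕ} (hU : IsOptimalPrefixMachine U)
    (m : ℕ) : {Q : TreeMeasure | Q.IsComputable ∧ Q.prefixComplexity U ≤ m}.Finite := by
  have hdesc (Q : TreeMeasure) : ∃ p, Q.IsComputable →
      p.length = Q.prefixComplexity U ∧ Q.DescribedBy U p := by
    by_cases hQ : Q.IsComputable
    · exact (hQ.exists_describedBy hU).imp fun p hp _ => hp
    · exact ⟨[], fun h => absurd h hQ⟩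
  choose d hd using hdesc
  refine Set.Finite.of_finite_image (f := d) ?_ ?_
  · refine (List.finite_length_le Bool m).subset ?_
    rintro _ ⟨Q, ⟨hQ, hm⟩, rfl⟩
    exact (hd Q hQ).1.trans_le hm
  · rintro Q ⟨hQ, -⟩ R ⟨hR, -⟩ h
    have hRd := (hd R hR).2
    rw [← h] at hRd
    exact (hd Q hQ).2.unique hRd

/-! ### Existence of best explanations -/

/-- The uniform measure on the binary tree. -/
def uniformTreeMeasure : TreeMeasure where
  val x := 1 / 2 ^ x.length
  nonneg x := by positivity
  val_nil := by simp
  val_append x := by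
    rw [List.length_append, List.length_append, List.length_singleton, List.length_singleton,
      pow_succ]
    field_simp
    norm_num

theorem uniformTreeMeasure_isComputable : uniformTreeMeasure.IsComputable := by
  have hpow : Primrec₂ fun m n : ℕ => m ^ n := Primrec₂.unpaired'.1 Nat.Primrec.pow
  have hf : Computable fun x : List Bool => Nat.pair 1 (2 ^ x.length) :=
    (Primrec₂.natPair.comp (Primrec.const 1)
      (hpow.comp (Primrec.const 2) Primrec.list_length)).to_comp
  obtain ⟨c, hc⟩ := Nat.Partrec.Code.exists_code.1 hf
  refine ⟨c, fun x => ⟨1, 2 ^ x.length, by positivity, ?_, by simp [uniformTreeMeasure]⟩⟩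
  rw [hc]
  simp

theorem TreeMeasure.val_le_one (Q : TreeMeasure) (x : List Bool) : Q.val x ≤ 1 := by
  induction x using List.reverseRecOn with
  | nil => exact Q.val_nil.le
  | append_singleton x b ih =>
    have h := Q.val_append x
    have h₀ := Q.nonneg (x ++ [false])
    have h₁ := Q.nonneg (x ++ [true])
    cases b <;> linarith

theorem TreeMeasure.quality_of_ne_zero {U : List Bool →. ℕ} {Q : TreeMeasure} {x : List Bool}
    (h : Q.val x ≠ 0) : Q.quality U x =
      ((3 * (Q.prefixComplexity U : ℝ) - Real.logb 2 (Q.val x : ℝ) : ℝ) : EReal) :=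
  if_neg h

theorem TreeMeasure.quality_of_eq_zero {U : List Bool →. ℕ} {Q : TreeMeasure} {x : List Bool}
    (h : Q.val x = 0) : Q.quality U x = ⊤ :=
  if_pos h

theorem TreeMeasure.prefixComplexity_le_quality {U : List Bool →. ℕ} (Q : TreeMeasure)
    (x : List Bool) : ((Q.prefixComplexity U : ℝ) : EReal) ≤ Q.quality U x := by
  by_cases h : Q.val x = 0
  · rw [Q.quality_of_eq_zero h]
    exact le_top
  · rw [Q.quality_of_ne_zero h, EReal.coe_le_coe_iff]
    have hlog : Real.logb 2 (Q.val x : ℝ) ≤ 0 :=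
      Real.logb_nonpos (by norm_num) (Rat.cast_nonneg.2 (Q.nonneg x))
        (by exact_mod_cast Q.val_le_one x)
    have hK : (0 : ℝ) ≤ Q.prefixComplexity U := Nat.cast_nonneg _
    linarith

theorem exists_isBestExplanation {U : List Bool →. ℕ} (hU : IsOptimalPrefixMachine U)
    (x : List Bool) : ∃ Q : TreeMeasure, IsBestExplanation U x Q := by
  have hu : uniformTreeMeasure.val x ≠ 0 := by simp [uniformTreeMeasure]
  obtain ⟨r, hr⟩ : ∃ r : ℝ, uniformTreeMeasure.quality U x = r :=
    ⟨_, TreeMeasure.quality_of_ne_zero hu⟩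
  obtain ⟨m, hm⟩ := exists_nat_ge r
  -- Whatever is at least as good as the uniform measure has complexity at most `m`.
  have hcompete (Q : TreeMeasure) (h : Q.quality U x ≤ uniformTreeMeasure.quality U x) :
      Q.prefixComplexity U ≤ m := by
    have hle := (Q.prefixComplexity_le_quality x).trans (h.trans_eq hr)
    exact_mod_cast (EReal.coe_le_coe_iff.1 hle).trans hm
  obtain ⟨Q, hQ, hmin⟩ := Set.exists_min_image _ (fun Q : TreeMeasure => Q.quality U x)
    (finite_setOf_prefixComplexity_le hU m)
    ⟨uniformTreeMeasure, uniformTreeMeasure_isComputable, hcompete _ le_rfl⟩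
  refine ⟨Q, hQ.1, fun R hR => ?_⟩
  rcases le_total (R.quality U x) (uniformTreeMeasure.quality U x) with h | h
  · exact hmin R ⟨hR, hcompete R h⟩
  · exact (hmin _ ⟨uniformTreeMeasure_isComputable, hcompete _ le_rfl⟩).trans h

/-! ### Prediction by best explanations -/

theorem IsBestExplanation.val_le {U : List Bool →. ℕ} {x : List Bool} {P Q : TreeMeasure}
    (hQ : IsBestExplanation U x Q) (hP : P.IsComputable) :
    (P.val x : ℝ) ≤ (2 : ℝ) ^ ((3 / 2 : ℝ) * P.prefixComplexity U) *
      (2 : ℝ) ^ (-(3 / 2) * (Q.prefixComplexity U : ℝ)) * √((P.val x : ℝ) * Q.val x) := by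
  rcases (P.nonneg x).eq_or_lt with hP0 | hPpos
  · simp [← hP0]
  have hle := hQ.2 P hP
  rw [P.quality_of_ne_zero hPpos.ne'] at hle
  have hQne : Q.val x ≠ 0 := fun h => by
    rw [Q.quality_of_eq_zero h, top_le_iff] at hle
    exact EReal.coe_ne_top _ hle
  rw [Q.quality_of_ne_zero hQne, EReal.coe_le_coe_iff] at hle
  have hp : (0 : ℝ) < P.val x := Rat.cast_pos.2 hPpos
  have hq : (0 : ℝ) < Q.val x := Rat.cast_pos.2 ((Q.nonneg x).lt_of_ne' hQne)
  generalize (P.val x : ℝ) = p at *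
  generalize (Q.val x : ℝ) = q at *
  have hp2 := Real.rpow_logb two_pos (by norm_num) hp
  have hq2 := Real.rpow_logb two_pos (by norm_num) hq
  generalize Real.logb 2 p = a at *
  generalize Real.logb 2 q = b at *
  subst hp2 hq2
  rw [Real.sqrt_eq_rpow, ← Real.rpow_add two_pos, ← Real.rpow_add two_pos,
    ← Real.rpow_mul two_pos.le, ← Real.rpow_add two_pos]
  exact Real.rpow_le_rpow_of_exponent_le one_le_two (by linarith)

/-- The bound on the finite partial sums, obtained by grouping the strings `x` according to the
shortest description of the explanation chosen for `x`. -/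
theorem sum_best_explanation_le {U : List Bool →. ℕ} (hU : IsOptimalPrefixMachine U)
    {best : List Bool → TreeMeasure} (hbest : ∀ x, IsBestExplanation U x (best x))
    {P : TreeMeasure} (hP : P.IsComputable) (s : Finset (List Bool)) :
    ∑ x ∈ s, (P.val x : ℝ) * ((P.cond false x : ℝ) - ((best x).cond false x : ℝ)) ^ 2 ≤
      4 * (1 - (2 : ℝ) ^ (-(1 / 2) : ℝ))⁻¹ *
        (2 : ℝ) ^ ((3 / 2 : ℝ) * (P.prefixComplexity U : ℝ)) := by
  classical
  choose d hlen hd using fun x => (hbest x).1.exists_describedBy hU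
  rw [← Finset.sum_fiberwise_of_maps_to (t := s.image d) fun x hx => Finset.mem_image_of_mem d hx]
  have hfiber : ∀ p ∈ s.image d, ∑ x ∈ s with d x = p,
      (P.val x : ℝ) * ((P.cond false x : ℝ) - ((best x).cond false x : ℝ)) ^ 2 ≤
      (2 : ℝ) ^ ((3 / 2 : ℝ) * P.prefixComplexity U) * 4 *
        (2 : ℝ) ^ (-(3 / 2) * (p.length : ℝ)) := by
    intro p hp
    obtain ⟨y, -, rfl⟩ := Finset.mem_image.1 hp
    calc _ ≤ ∑ x ∈ s with d x = d y, (2 : ℝ) ^ ((3 / 2 : ℝ) * P.prefixComplexity U) *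
          (2 : ℝ) ^ (-(3 / 2) * ((d y).length : ℝ)) *
          (√((P.val x : ℝ) * (best y).val x) *
            ((P.cond false x : ℝ) - ((best y).cond false x : ℝ)) ^ 2) := by
          refine Finset.sum_le_sum fun x hx => ?_
          have hxy : best x = best y := by
            have hdx := hd x
            rw [(Finset.mem_filter.1 hx).2] at hdx
            exact hdx.unique (hd y)
          have h := (hbest x).val_le hP
          rw [hxy] at h ⊢
          rw [hlen, ← mul_assoc]
          exact mul_le_mul_of_nonneg_right h (sq_nonneg _)
      _ ≤ (2 : ℝ) ^ ((3 / 2 : ℝ) * P.prefixComplexity U) *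
          (2 : ℝ) ^ (-(3 / 2) * ((d y).length : ℝ)) * 4 := by
          rw [← Finset.mul_sum]
          exact mul_le_mul_of_nonneg_left (P.sum_sqrt_mul_sq_le (best y) _) (by positivity)
      _ = _ := by ring
  refine (Finset.sum_le_sum hfiber).trans ?_
  rw [← Finset.mul_sum]
  refine (mul_le_mul_of_nonneg_left (sum_two_rpow_neg_length_le _) (by positivity)).trans_eq ?_
  ring

theorem theorem3 (U : List Bool →. ℕ) (hU : IsOptimalPrefixMachine U) :
    (∀ x : List Bool, ∃ Q : TreeMeasure, IsBestExplanation U x Q) ∧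
    ∃ C : ℝ, ∀ best : List Bool → TreeMeasure, (∀ x, IsBestExplanation U x (best x)) →
      ∀ P : TreeMeasure, P.IsComputable →
        Summable (fun x : List Bool =>
          (P.val x : ℝ) * ((P.cond false x : ℝ) - ((best x).cond false x : ℝ)) ^ 2) ∧
        ∑' x : List Bool,
            (P.val x : ℝ) * ((P.cond false x : ℝ) - ((best x).cond false x : ℝ)) ^ 2 ≤
          C * ((P.prefixComplexity U : ℝ) *
            (2 : ℝ) ^ ((3 / 2 : ℝ) * (P.prefixComplexity U : ℝ))) := by
  refine ⟨exists_isBestExplanation hU, 4 * (1 - (2 : ℝ) ^ (-(1 / 2) : ℝ))⁻¹,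
    fun best hbest P hP => ?_⟩
  have hnonneg : 0 ≤ fun x : List Bool =>
      (P.val x : ℝ) * ((P.cond false x : ℝ) - ((best x).cond false x : ℝ)) ^ 2 :=
    fun x => mul_nonneg (Rat.cast_nonneg.2 (P.nonneg x)) (sq_nonneg _)
  have hsum := sum_best_explanation_le hU hbest hP
  refine ⟨summable_of_sum_le hnonneg hsum, (Real.tsum_le_of_sum_le hnonneg hsum).trans ?_⟩
  have hK : (1 : ℝ) ≤ P.prefixComplexity U := by exact_mod_cast hP.prefixComplexity_pos hU
  have hC : 0 ≤ 4 * (1 - (2 : ℝ) ^ (-(1 / 2) : ℝ))⁻¹ :=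
    mul_nonneg (by norm_num) (inv_nonneg.2 (sub_nonneg.2 two_rpow_neg_half_lt_one.le))
  exact mul_le_mul_of_nonneg_left (le_mul_of_one_le_left (by positivity) hK) hC
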